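/- Let $n\ge 0$ be an integer. There is a function $C=C_n:\mathbb R\times\mathbb R\to(0,\infty)$ with the following property. Let $X$ be a compact complex manifold of complex dimension $n$ with a Kähler form $\omega$, let $\eta$ be a smooth closed real $(1,1)$-form on $X$, let $h\in C^\infty(X,\mathbb R)$ and $T>0$. Put $dd^c=\frac{i}{\pi}\partial\bar\partial$, let $\mathrm{Ric}(\omega)=-dd^c\log\omega^n$ be the Ricci form, set $\theta_t=\omega+t\eta-t\,\mathrm{Ric}(\omega)$, and assume $\frac12\omega\le\theta_t\le2\omega$ for $0<t\le T$. Let $\varphi_0\in C^\infty(X,\mathbb R)$ be strictly $\omega$-plurisubharmonic, i.e. $\omega+dd^c\varphi_0>0$, and let $(t,x)\mapsto\varphi_t(x)$ be a $C^\infty$ function on $[0,T]\times X$ equal to $\varphi_0$ at $t=0$, such that for $0<t\le T$ one has $\theta_t+dd^c\varphi_t>0$ and $$\frac{\partial\varphi_t}{\partial t}=\log\left[\frac{(\theta_t+dd^c\varphi_t)^n}{e^h\,\omega^n}\right].$$ Then, with $C=C_n(\sup_X\varphi_0,\,-\inf_X h)$, for all $0<t\le T$ and all $x\in X$, $$\dot\varphi_t(x)\le\frac{-\varphi_0(x)+C}{t}+C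 .$$ Here $\dot\varphi_t=\partial\varphi_t/\partial t$, a one-sided derivative at $t=T$. -/

import Mathlib

open Set
open scoped Manifold ContDiff

noncomputable section

namespace KRF

/-- The model space `ℂⁿ` of a complex manifold of complex dimension `n`. -/
abbrev E (n : ℕ) : Type := EuclideanSpace ℂ (Fin n)

/-- Real-valued alternating 2-forms on the real vector space underlying `ℂⁿ`. -/
abbrev Alt2 (n : ℕ) : Type := E n [⋀^Fin 2]→L[ℝ] ℝ

/-- A (not necessarily smooth) real 2-form on `X`. As everywhere in Mathlib, the tangent space of
`X` at `x` is the model space `ℂⁿ`, identified by means of the preferred chart `chartAt _ x`. -/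
abbrev TwoForm (n : ℕ) (X : Type*) : Type _ := X → Alt2 n

section Linear

variable {n : ℕ}

/-- A real alternating form `a` on `ℂⁿ` is of type `(1,1)` iff it is invariant under `v ↦ i v`. -/
def Alt2.IsOneOne (a : Alt2 n) : Prop :=
  ∀ v w : E n, a ![Complex.I • v, Complex.I • w] = a ![v, w]

/-- The coefficients `a_{jk}` of a real `(1,1)`-form `a = i ∑ a_{jk} dz_j ∧ dz̄_k` on `ℂⁿ`:
`a_{jk} = (a(e_j, i e_k) - i a(e_j, e_k)) / 2`. -/
def Alt2.coeff (a : Alt2 n) : Matrix (Fin n) (Fin n) ℂ :=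
  Matrix.of fun j k =>
    ((a ![EuclideanSpace.single j 1, Complex.I • EuclideanSpace.single k 1] : ℂ)
      - Complex.I * (a ![EuclideanSpace.single j 1, EuclideanSpace.single k 1] : ℂ)) / 2

/-- The determinant of the coefficients of a real `(1,1)`-form on `ℂⁿ` (a real number, since the
coefficients form a Hermitian matrix). The top power of the form is
`aⁿ = n! · det (a_{jk}) · (i dz₁ ∧ dz̄₁) ∧ ⋯ ∧ (i dz_n ∧ dz̄_n)`. -/
def Alt2.topCoeff (a : Alt2 n) : ℝ := (a.coeff.det).re

/-- `d^c f = (1 / 2πi) (∂f - ∂̄f)` for a real function `f` on `ℂⁿ`, that is,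
`(d^c f)_z (v) = -(1 / 2π) (df)_z (i v)`. -/
def dcLocal (f : E n → ℝ) (z : E n) : E n [⋀^Fin 1]→L[ℝ] ℝ :=
  ContinuousAlternatingMap.ofSubsingletonLIE (0 : Fin 1)
    ((-(1 / (2 * Real.pi))) •
      (fderiv ℝ f z).comp
        ((Complex.I • ContinuousLinearMap.id ℂ (E n)).restrictScalars ℝ))

/-- `dd^c f = (i / π) ∂∂̄ f` for a real function `f` on `ℂⁿ`: the exterior derivative of
`d^c f`. -/
def ddcLocal (f : E n → ℝ) (z : E n) : Alt2 n := extDeriv (dcLocal f) z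

end Linear

section Forms

variable {n : ℕ} {X : Type*} [TopologicalSpace X] [ChartedSpace (E n) X]

/-- The expression of a 2-form in the chart `e`: its pullback under `e.symm`. Tangent vectors at
`e.symm z` being read in the preferred chart there, the differential of `e.symm` at `z` is the
differential at `z` of the change of coordinates to that chart. -/
def inChart (e : OpenPartialHomeomorph X (E n)) (α : TwoForm n X) (z : E n) : Alt2 n :=
  (α (e.symm z)).compContinuousLinearMap
    (fderiv ℝ (fun w => chartAt (E n) (e.symm z) (e.symm w)) z)

/-- The 2-form `α` is `C^∞` (in the sense of real calculus). -/
def IsSmoothForm (α : TwoForm n X) : Prop :=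
  ∀ e ∈ atlas (E n) X, ContDiffOn ℝ ∞ (inChart e α) e.target

/-- `dα = 0`. -/
def IsClosedForm (α : TwoForm n X) : Prop :=
  ∀ e ∈ atlas (E n) X, ∀ z ∈ e.target, extDeriv (inChart e α) z = 0

/-- `α` is of type `(1,1)`. -/
def IsOneOneForm (α : TwoForm n X) : Prop := ∀ x, (α x).IsOneOne

/-- `α > 0`, for a real `(1,1)`-form `α`. -/
def IsPositiveForm (α : TwoForm n X) : Prop :=
  ∀ (x : X) (v : E n), v ≠ 0 → 0 < α x ![v, Complex.I • v]

/-- `α ≤ β`, for real `(1,1)`-forms `α` and `β`. -/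
def FormLE (α β : TwoForm n X) : Prop :=
  ∀ (x : X) (v : E n), α x ![v, Complex.I • v] ≤ β x ![v, Complex.I • v]

/-- Kähler forms: smooth closed positive real `(1,1)`-forms. -/
structure IsKahlerForm (Ω : TwoForm n X) : Prop where
  smooth : IsSmoothForm Ω
  closed : IsClosedForm Ω
  oneOne : IsOneOneForm Ω
  pos : IsPositiveForm Ω

/-- `dd^c f` for a real function `f` on `X`, computed at `x` in the preferred chart at `x`
(it does not depend on the holomorphic chart). -/
def ddc (f : X → ℝ) : TwoForm n X := fun x =>
  ddcLocal (f ∘ (chartAt (E n) x).symm) (chartAt (E n) x x)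

/-- The Ricci form `Ric(Ω) = - dd^c log Ωⁿ`, that is, `- dd^c log det (Ω_{jk})` in holomorphic
coordinates. -/
def ricci (Ω : TwoForm n X) : TwoForm n X := fun x =>
  - ddcLocal (fun z => Real.log (inChart (chartAt (E n) x) Ω z).topCoeff) (chartAt (E n) x x)

/-- The ratio of top-degree forms `αⁿ / Ωⁿ`, as a function on `X`. -/
def topRatio (α Ω : TwoForm n X) (x : X) : ℝ := (α x).topCoeff / (Ω x).topCoeff

/-- `θ_t = Ω + t η - t Ric(Ω)`. -/
def theta (Ω η : TwoForm n X) (t : ℝ) : TwoForm n X := Ω + t • η - t • ricci Ω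

/-- A real function `φ` on `X` is smooth and strictly `θ`-plurisubharmonic: `θ + dd^c φ > 0`. -/
def IsSmoothStrictlyPSH (θ : TwoForm n X) (φ : X → ℝ) : Prop :=
  ContMDiff 𝓘(ℝ, E n) 𝓘(ℝ, ℝ) ∞ φ ∧ IsPositiveForm (θ + ddc φ)

/-- `φ` is a smooth solution on `[0,T] × X` of the complex Monge-Ampère flow
`∂φ_t/∂t = log ((θ_t + dd^c φ_t)ⁿ / (e^h Ωⁿ))` with initial value `φ₀`, the functions `φ_t` being
strictly `θ_t`-plurisubharmonic. -/
structure IsCMAFSolution (Ω η : TwoForm n X) (h φ₀ : X → ℝ) (T : ℝ) (φ : ℝ → X → ℝ) : Prop where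
  smooth : ContMDiffOn (𝓘(ℝ, ℝ).prod 𝓘(ℝ, E n)) 𝓘(ℝ, ℝ) ∞
    (fun p : ℝ × X => φ p.1 p.2) (Icc 0 T ×ˢ univ)
  initial : φ 0 = φ₀
  psh : ∀ t ∈ Ioc 0 T, IsSmoothStrictlyPSH (theta Ω η t) (φ t)
  flow : ∀ t ∈ Ioc 0 T, ∀ x : X,
    derivWithin (fun s => φ s x) (Icc 0 T) t =
      Real.log (topRatio (theta Ω η t + ddc (φ t)) Ω x / Real.exp (h x))

end Forms

end KRF

end

/-! Write `θ_t = Ω + tχ` with `χ = η - Ric(Ω)`. The core is a comparison of the flow with its own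
time rescaling. For `l ≥ 1` put `u_s = l⁻¹ φ_{ls} + (1 - l⁻¹) φ₀`, whose time derivative is the
velocity of `φ` at time `ls`. Since `l θ_s - θ_{ls} = (l - 1) Ω`, at a spatial maximum of `u_s -
φ_s` one gets `l (θ_s + dd^c φ_s) ≥ θ_{ls} + dd^c φ_{ls} + (l - 1)(Ω + dd^c φ₀)`, and the last term
is nonnegative. Monotonicity of the determinant bounds the difference of velocities by `n log l`, so
the maximum principle yields `u_s - φ_s ≤ s n log l` (`rescaled_le`).

Taking `l = t / s` and letting `s` increase to `t` turns this into `φ̇_t ≤ (φ_t - φ₀) / t + n`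
(`derivWithin_le`). The same maximum principle with `θ_t ≤ 2Ω` gives `φ_t ≤ sup φ₀ + t (n log 2 -
inf h)` (`le_add_mul`), and the two bounds combine. -/

namespace KRF

/-! ### Monotonicity of the determinant on positive definite matrices. -/

section Determinants

open scoped ComplexOrder MatrixOrder
open Matrix

variable {ι : Type*} [Fintype ι] [DecidableEq ι]

lemma one_le_re_det_one_add {Q : Matrix ι ι ℂ} (hQ : Q.PosSemidef) :
    1 ≤ ((1 + Q).det).re := by
  have hH : (1 + Q).IsHermitian := isHermitian_one.add hQ.1
  have h1 : ∀ i, 1 ≤ hH.eigenvalues i := by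
    intro i
    have hv := hH.mulVec_eigenvectorBasis i
    set u : ι → ℂ := ⇑(hH.eigenvectorBasis i) with hu
    have hQu : Q *ᵥ u = (hH.eigenvalues i - 1 : ℝ) • u := by
      rw [add_mulVec, one_mulVec] at hv
      rw [sub_smul, one_smul, ← hv, add_sub_cancel_left]
    have h2 := hQ.re_dotProduct_nonneg u
    have h3 : star u ⬝ᵥ u = 1 := by
      have h4 := (hH.eigenvectorBasis).orthonormal.1 i
      have h5 := inner_self_eq_norm_sq_to_K (𝕜 := ℂ) (hH.eigenvectorBasis i)
      rw [h4, EuclideanSpace.inner_eq_star_dotProduct, dotProduct_comm] at h5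
      simpa using h5
    rw [hQu, dotProduct_smul, h3] at h2
    simpa using h2
  have hdet := hH.det_eq_prod_eigenvalues
  rw [hdet]
  have : (∏ i, ((hH.eigenvalues i : ℝ) : ℂ)).re = ∏ i, hH.eigenvalues i := by
    rw [← Complex.ofReal_prod, Complex.ofReal_re]
  refine le_trans ?_ this.ge
  exact Finset.one_le_prod fun i _ => h1 i

/-- Factor `A = S* S` with `S` invertible. Then `B = S* (1 + Q) S` with `Q ≥ 0`, so `det B = det A ·
det (1 + Q)` and the second factor is at least 1. -/
lemma re_det_le_re_det {A B : Matrix ι ι ℂ} (hA : A.PosDef) (hAB : (B - A).PosSemidef) :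
    (A.det).re ≤ (B.det).re := by
  obtain ⟨S, hS, rfl⟩ := (CStarAlgebra.isStrictlyPositive_iff_eq_star_mul_self (a := A)).1
    hA.isStrictlyPositive
  have hSd : IsUnit S.det := (isUnit_iff_isUnit_det S).1 hS
  set Q := (S⁻¹)ᴴ * (B - star S * S) * S⁻¹ with hQdef
  have hQ : Q.PosSemidef := hAB.conjTranspose_mul_mul_same _
  have hB : B = Sᴴ * (1 + Q) * S := by
    have e1 : Sᴴ * (S⁻¹)ᴴ = 1 := by
      rw [← conjTranspose_mul, nonsing_inv_mul _ hSd, conjTranspose_one]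
    have e2 : Sᴴ * Q * S = B - star S * S := by
      rw [hQdef, ← Matrix.mul_assoc, ← Matrix.mul_assoc, e1, Matrix.one_mul, Matrix.mul_assoc,
        nonsing_inv_mul _ hSd, Matrix.mul_one]
    rw [Matrix.mul_add, Matrix.add_mul, Matrix.mul_one, e2, star_eq_conjTranspose]
    abel
  have hpos := hA.det_pos
  have hBd : B.det = (star S * S).det * (1 + Q).det := by
    conv_lhs => rw [hB]
    rw [det_mul, det_mul, det_mul, star_eq_conjTranspose]
    ring
  obtain ⟨hre, him⟩ := Complex.pos_iff.1 hpos
  rw [hBd, Complex.mul_re, ← him, zero_mul, sub_zero]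
  exact le_mul_of_one_le_right hre.le (one_le_re_det_one_add hQ)

end Determinants

/-! ### Real (1,1)-forms and their Hermitian coefficient matrices. -/

section Coefficients

open scoped ComplexOrder
open Matrix

variable {n : ℕ}

namespace Alt2

lemma apply_add_left (a : Alt2 n) (u v w : E n) : a ![u + v, w] = a ![u, w] + a ![v, w] :=
  a.toAlternatingMap.map_vecCons_add ![w] u v

lemma apply_smul_left (a : Alt2 n) (c : ℝ) (v w : E n) : a ![c • v, w] = c * a ![v, w] :=
  a.toAlternatingMap.map_vecCons_smul ![w] c v

lemma apply_swap (a : Alt2 n) (v w : E n) : a ![w, v] = - a ![v, w] := by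
  have := a.toAlternatingMap.map_swap ![v, w] (i := 0) (j := 1) (by decide)
  rw [← show ![v, w] ∘ Equiv.swap (0 : Fin 2) 1 = ![w, v] by
    ext i : 1; fin_cases i <;> simp]
  exact this

lemma apply_add_right (a : Alt2 n) (u v w : E n) : a ![w, u + v] = a ![w, u] + a ![w, v] := by
  rw [apply_swap, apply_add_left, apply_swap a w u, apply_swap a w v]; ring

lemma apply_smul_right (a : Alt2 n) (c : ℝ) (v w : E n) : a ![w, c • v] = c * a ![w, v] := by
  rw [apply_swap, apply_smul_left, apply_swap a w v]; ring

lemma complex_smul (c : ℂ) (v : E n) : c • v = c.re • v + c.im • (Complex.I • v) := by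
  conv_lhs => rw [← Complex.re_add_im c, add_smul, mul_smul]
  rfl

lemma apply_I_I_right (a : Alt2 n) (v w : E n) :
    a ![v, Complex.I • Complex.I • w] = - a ![v, w] := by
  have : Complex.I • Complex.I • w = (-1 : ℝ) • w := by
    rw [smul_smul, Complex.I_mul_I]; simp
  rw [this, apply_smul_right]; ring

lemma IsOneOne.apply_I_left {a : Alt2 n} (ha : a.IsOneOne) (v w : E n) :
    a ![Complex.I • v, w] = - a ![v, Complex.I • w] := by
  rw [← ha v (Complex.I • w), apply_I_I_right, neg_neg]

/-- The sesquilinear form on `ℂⁿ` associated with a real `(1,1)`-form. -/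
noncomputable def IsOneOne.sesq {a : Alt2 n} (ha : a.IsOneOne) : E n →ₗ[ℂ] E n →ₗ⋆[ℂ] ℂ :=
  LinearMap.mk₂'ₛₗ (RingHom.id ℂ) (starRingEnd ℂ)
    (fun v w => ((a ![v, Complex.I • w] : ℂ) - Complex.I * (a ![v, w] : ℂ)) / 2)
    (fun u v w => by rw [apply_add_left, apply_add_left]; push_cast; ring)
    (fun c v w => by
      rw [complex_smul]
      simp only [apply_add_left, apply_smul_left, ha.apply_I_left, apply_I_I_right]
      rw [RingHom.id_apply, smul_eq_mul]
      conv_rhs => rw [← Complex.re_add_im c]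
      push_cast
      linear_combination (c.im : ℂ) * (a ![v, w] : ℂ) / 2 * Complex.I_sq)
    (fun u v w => by rw [smul_add, apply_add_right, apply_add_right]; push_cast; ring)
    (fun c v w => by
      rw [complex_smul c, smul_add, smul_comm Complex.I c.re w, smul_comm Complex.I c.im]
      simp only [apply_add_right, apply_smul_right, apply_I_I_right]
      rw [smul_eq_mul]
      conv_rhs => rw [← Complex.re_add_im c]
      rw [map_add, map_mul, Complex.conj_ofReal, Complex.conj_ofReal, Complex.conj_I]
      push_cast
      linear_combination -(c.im : ℂ) * (a ![v, w] : ℂ) / 2 * Complex.I_sq)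

lemma IsOneOne.sesq_apply {a : Alt2 n} (ha : a.IsOneOne) (v w : E n) :
    ha.sesq v w = ((a ![v, Complex.I • w] : ℂ) - Complex.I * (a ![v, w] : ℂ)) / 2 := rfl

lemma apply_self (a : Alt2 n) (v : E n) : a ![v, v] = 0 := by
  have := apply_swap a v v; linarith

/-- Transfers positivity between the form and its matrix. The vector is `star x` because `sesq` is
linear in the row index and antilinear in the column index, the opposite of `star x ⬝ᵥ (A *ᵥ x)`. -/
lemma IsOneOne.dotProduct_coeff {a : Alt2 n} (ha : a.IsOneOne) (x : Fin n → ℂ) :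
    star x ⬝ᵥ (a.coeff *ᵥ x) =
      ((a ![WithLp.toLp 2 (star x), Complex.I • WithLp.toLp 2 (star x)] / 2 : ℝ) : ℂ) := by
  set v : E n := WithLp.toLp 2 (star x) with hv
  have h1 : ha.sesq v v = ((a ![v, Complex.I • v] / 2 : ℝ) : ℂ) := by
    rw [ha.sesq_apply, apply_self]; push_cast; ring
  have h2 : v = ∑ j, star (x j) • EuclideanSpace.single j (1 : ℂ) := by
    ext i
    simp [hv, Finset.sum_apply, Pi.single_apply]
  rw [← h1]
  have h3 : ha.sesq v = ∑ j, star (x j) • ha.sesq (EuclideanSpace.single j (1 : ℂ)) := by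
    conv_lhs => rw [h2]
    rw [map_sum]
    exact Finset.sum_congr rfl fun j _ => map_smul _ _ _
  rw [h3, LinearMap.sum_apply, dotProduct]
  refine Finset.sum_congr rfl fun j _ => ?_
  rw [LinearMap.smul_apply, mulVec, dotProduct, Pi.star_apply, smul_eq_mul]
  conv_rhs => rw [h2, map_sum]
  congr 1
  refine Finset.sum_congr rfl fun k _ => ?_
  rw [LinearMap.map_smulₛₗ, smul_eq_mul, mul_comm]
  simp [coeff, ha.sesq_apply]

lemma IsOneOne.isHermitian_coeff {a : Alt2 n} (ha : a.IsOneOne) : a.coeff.IsHermitian := by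
  ext j k
  have h := ha.apply_I_left (EuclideanSpace.single j (1 : ℂ)) (EuclideanSpace.single k 1)
  have h1 := apply_swap a (EuclideanSpace.single j (1 : ℂ)) (EuclideanSpace.single k 1)
  have h2 := apply_swap a (Complex.I • EuclideanSpace.single j (1 : ℂ)) (EuclideanSpace.single k 1)
  simp only [conjTranspose_apply, coeff, of_apply, h1, h2, h]
  simp [sub_eq_add_neg]

lemma IsOneOne.posSemidef_coeff {a : Alt2 n} (ha : a.IsOneOne)
    (h : ∀ v : E n, 0 ≤ a ![v, Complex.I • v]) : a.coeff.PosSemidef := by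
  refine .of_dotProduct_mulVec_nonneg ha.isHermitian_coeff fun x => ?_
  rw [ha.dotProduct_coeff]
  exact Complex.zero_le_real.2 (by linarith [h (WithLp.toLp 2 (star x))])

lemma IsOneOne.posDef_coeff {a : Alt2 n} (ha : a.IsOneOne)
    (h : ∀ v : E n, v ≠ 0 → 0 < a ![v, Complex.I • v]) : a.coeff.PosDef := by
  refine .of_dotProduct_mulVec_pos ha.isHermitian_coeff fun x hx => ?_
  rw [ha.dotProduct_coeff]
  refine Complex.zero_lt_real.2 (half_pos (h _ fun h0 => hx ?_))
  have : star x = 0 := by simpa using h0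
  simpa using this

lemma IsOneOne.topCoeff_pos {a : Alt2 n} (ha : a.IsOneOne)
    (h : ∀ v : E n, v ≠ 0 → 0 < a ![v, Complex.I • v]) : 0 < a.topCoeff :=
  (Complex.pos_iff.1 (ha.posDef_coeff h).det_pos).1

lemma coeff_sub (a b : Alt2 n) : (a - b).coeff = a.coeff - b.coeff := by
  ext j k
  simp only [coeff, of_apply, Matrix.sub_apply, ContinuousAlternatingMap.sub_apply]
  push_cast; ring

lemma coeff_smul (c : ℝ) (a : Alt2 n) : (c • a).coeff = (c : ℂ) • a.coeff := by
  ext j k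
  simp only [coeff, of_apply, Matrix.smul_apply, ContinuousAlternatingMap.smul_apply, smul_eq_mul]
  push_cast; ring

lemma topCoeff_smul (c : ℝ) (a : Alt2 n) : (c • a).topCoeff = c ^ n * a.topCoeff := by
  rw [topCoeff, coeff_smul, det_smul, Fintype.card_fin, ← Complex.ofReal_pow,
    Complex.re_ofReal_mul, topCoeff]

lemma IsOneOne.add {a b : Alt2 n} (ha : a.IsOneOne) (hb : b.IsOneOne) : (a + b).IsOneOne :=
  fun v w => by simp only [ContinuousAlternatingMap.add_apply, ha v w, hb v w]

lemma IsOneOne.neg {a : Alt2 n} (ha : a.IsOneOne) : (-a).IsOneOne :=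
  fun v w => by simp only [ContinuousAlternatingMap.neg_apply, ha v w]

lemma IsOneOne.sub {a b : Alt2 n} (ha : a.IsOneOne) (hb : b.IsOneOne) : (a - b).IsOneOne :=
  fun v w => by simp only [ContinuousAlternatingMap.sub_apply, ha v w, hb v w]

lemma IsOneOne.smul {a : Alt2 n} (ha : a.IsOneOne) (c : ℝ) : (c • a).IsOneOne :=
  fun v w => by simp only [ContinuousAlternatingMap.smul_apply, ha v w]

lemma topCoeff_le_topCoeff {a b : Alt2 n} (ha : a.IsOneOne) (hb : b.IsOneOne)
    (hpos : ∀ v : E n, v ≠ 0 → 0 < a ![v, Complex.I • v])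
    (hab : ∀ v : E n, a ![v, Complex.I • v] ≤ b ![v, Complex.I • v]) :
    a.topCoeff ≤ b.topCoeff := by
  refine re_det_le_re_det (ha.posDef_coeff hpos) ?_
  rw [← coeff_sub]
  refine (hb.sub ha).posSemidef_coeff fun v => ?_
  rw [ContinuousAlternatingMap.sub_apply]
  exact sub_nonneg.2 (hab v)

end Alt2

end Coefficients

end KRF
namespace KRF

/-! ### Second derivatives at a local maximum. -/

section SecondDerivatives

open Filter Topology

variable {F : Type*} [NormedAddCommGroup F] [NormedSpace ℝ F]

lemma _root_.ContDiffAt.eventually_differentiableAt {f : F → ℝ} {z : F} (hf : ContDiffAt ℝ 2 f z) :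
    ∀ᶠ w in 𝓝 z, DifferentiableAt ℝ f w :=
  (hf.eventually (by simp)).mono fun _ hw => hw.differentiableAt (by simp)

lemma _root_.ContDiffAt.differentiableAt_fderiv {f : F → ℝ} {z : F} (hf : ContDiffAt ℝ 2 f z) :
    DifferentiableAt ℝ (fderiv ℝ f) z :=
  (hf.fderiv_right (m := 1) (by norm_num)).differentiableAt (by simp)

/-- The second derivative of a `C²` function is nonpositive at a local maximum. -/
lemma _root_.IsLocalMax.fderiv_fderiv_nonpos {f : F → ℝ} {z : F} (hmax : IsLocalMax f z)
    (hf : ContDiffAt ℝ 2 f z) (v : F) : fderiv ℝ (fderiv ℝ f) z v v ≤ 0 := by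
  set ℓ : ℝ → F := fun s => z + s • v with hℓ
  have hℓ0 : ℓ 0 = z := by simp [hℓ]
  have hℓd : ∀ s, HasDerivAt ℓ v s := fun s => by
    have := ((hasDerivAt_id s).smul_const v).const_add z
    rwa [one_smul] at this
  have hℓt : Tendsto ℓ (𝓝 0) (𝓝 z) := by
    have := (hℓd 0).continuousAt.tendsto
    rwa [hℓ0] at this
  have hd1 : deriv (f ∘ ℓ) =ᶠ[𝓝 0] fun s => fderiv ℝ f (ℓ s) v := by
    filter_upwards [hℓt.eventually hf.eventually_differentiableAt] with s hs
    exact (hs.hasFDerivAt.comp_hasDerivAt s (hℓd s)).deriv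
  have hd2 : deriv (deriv (f ∘ ℓ)) 0 = fderiv ℝ (fderiv ℝ f) z v v := by
    rw [hd1.deriv_eq]
    have h1 : HasFDerivAt (fderiv ℝ f) (fderiv ℝ (fderiv ℝ f) z) (ℓ 0) := by
      rw [hℓ0]; exact hf.differentiableAt_fderiv.hasFDerivAt
    have h2 := h1.comp_hasDerivAt (0 : ℝ) (hℓd 0)
    exact (h2.clm_apply (hasDerivAt_const (0 : ℝ) v)).deriv.trans (by simp)
  have hm : IsLocalMax (f ∘ ℓ) 0 := by
    have := hℓt.eventually hmax
    simpa [IsLocalMax, IsMaxFilter, hℓ0] using this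
  rw [← hd2]
  by_contra! hpos
  -- A positive second derivative would make 0 a local minimum as well, so `f ∘ ℓ` would be locally
  -- constant, with zero second derivative.
  have hmin : IsLocalMin (f ∘ ℓ) 0 := by
    refine isLocalMin_of_deriv_deriv_pos hpos hm.deriv_eq_zero ?_
    refine ContinuousAt.comp ?_ (hℓd 0).continuousAt
    rw [hℓ0]; exact hf.continuousAt
  have hconst : f ∘ ℓ =ᶠ[𝓝 0] fun _ => (f ∘ ℓ) 0 := by
    filter_upwards [hm, hmin] with s h1 h2 using le_antisymm h1 h2
  have h0 : deriv (deriv (f ∘ ℓ)) 0 = 0 := by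
    rw [hconst.deriv.deriv_eq]; simp
  linarith

lemma fderiv_fderiv_add {f g : F → ℝ} {z : F} (hf : ContDiffAt ℝ 2 f z) (hg : ContDiffAt ℝ 2 g z) :
    fderiv ℝ (fderiv ℝ (f + g)) z = fderiv ℝ (fderiv ℝ f) z + fderiv ℝ (fderiv ℝ g) z := by
  have h : fderiv ℝ (f + g) =ᶠ[𝓝 z] fderiv ℝ f + fderiv ℝ g := by
    filter_upwards [hf.eventually_differentiableAt, hg.eventually_differentiableAt] with w h1 h2
    exact fderiv_add h1 h2
  rw [h.fderiv_eq, fderiv_add hf.differentiableAt_fderiv hg.differentiableAt_fderiv]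

lemma fderiv_fderiv_const_smul {f : F → ℝ} {z : F} (hf : ContDiffAt ℝ 2 f z) (c : ℝ) :
    fderiv ℝ (fderiv ℝ (c • f)) z = c • fderiv ℝ (fderiv ℝ f) z := by
  have h : fderiv ℝ (c • f) =ᶠ[𝓝 z] c • fderiv ℝ f := by
    filter_upwards [hf.eventually_differentiableAt] with w h1
    exact fderiv_const_smul h1 c
  rw [h.fderiv_eq, fderiv_const_smul hf.differentiableAt_fderiv]

end SecondDerivatives

/-! ### The operator `dd^c` on `ℂⁿ` in terms of the real Hessian. -/

section LocalDdc

open Filter Topology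

variable {n : ℕ}

lemma dcLocal_apply (f : E n → ℝ) (z : E n) (v : Fin 1 → E n) :
    dcLocal f z v = -(1 / (2 * Real.pi)) * fderiv ℝ f z (Complex.I • v 0) := by
  simp [dcLocal, ContinuousAlternatingMap.ofSubsingletonLIE]

lemma differentiableAt_dcLocal {f : E n → ℝ} {z : E n} (hf : ContDiffAt ℝ 2 f z) :
    DifferentiableAt ℝ (dcLocal f) z := by
  have h : DifferentiableAt ℝ (fun w => (-(1 / (2 * Real.pi))) • (fderiv ℝ f w).comp
      ((Complex.I • ContinuousLinearMap.id ℂ (E n)).restrictScalars ℝ)) z :=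
    (hf.differentiableAt_fderiv.clm_comp (differentiableAt_const _)).fun_const_smul _
  exact (ContinuousAlternatingMap.ofSubsingletonLIE (𝕜 := ℝ) (E := E n) (F := ℝ)
    (0 : Fin 1)).toContinuousLinearEquiv.differentiableAt.comp z h

lemma ddcLocal_apply {f : E n → ℝ} {z : E n} (hf : ContDiffAt ℝ 2 f z) (v w : E n) :
    ddcLocal f z ![v, w] = 1 / (2 * Real.pi) *
      (fderiv ℝ (fderiv ℝ f) z w (Complex.I • v) - fderiv ℝ (fderiv ℝ f) z v (Complex.I • w)) := by
  have key : ∀ (u : Fin 1 → E n) (y : E n), fderiv ℝ (fun x => dcLocal f x u) z y =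
      -(1 / (2 * Real.pi)) * fderiv ℝ (fderiv ℝ f) z y (Complex.I • u 0) := by
    intro u y
    simp only [dcLocal_apply]
    rw [fderiv_const_mul (hf.differentiableAt_fderiv.clm_apply (differentiableAt_const _)),
      fderiv_clm_apply hf.differentiableAt_fderiv (differentiableAt_const _)]
    simp
  rw [ddcLocal, extDeriv_apply (differentiableAt_dcLocal hf), Fin.sum_univ_two, key, key]
  simp [Fin.removeNth]
  ring

/-- Up to a positive factor, this is the trace of the Hessian on the complex line spanned by `v`;
hence it is nonpositive at a local maximum. -/
lemma ddcLocal_diag {f : E n → ℝ} {z : E n} (hf : ContDiffAt ℝ 2 f z) (v : E n) :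
    ddcLocal f z ![v, Complex.I • v] = 1 / (2 * Real.pi) *
      (fderiv ℝ (fderiv ℝ f) z v v
        + fderiv ℝ (fderiv ℝ f) z (Complex.I • v) (Complex.I • v)) := by
  rw [ddcLocal_apply hf, smul_smul, Complex.I_mul_I, neg_one_smul, map_neg]
  ring

lemma isOneOne_ddcLocal {f : E n → ℝ} {z : E n} (hf : ContDiffAt ℝ 2 f z) :
    (ddcLocal f z).IsOneOne := by
  intro v w
  have hs := hf.isSymmSndFDerivAt (by simp)
  rw [ddcLocal_apply hf, ddcLocal_apply hf, smul_smul, smul_smul, Complex.I_mul_I, neg_one_smul,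
    neg_one_smul, map_neg, map_neg, hs.eq (Complex.I • w) v, hs.eq (Complex.I • v) w]
  ring

end LocalDdc

/-! ### Forms on the manifold, and the sign of `dd^c` at a spatial maximum. -/

section Manifold

open Filter Topology

variable {n : ℕ} {X : Type*} [TopologicalSpace X] [ChartedSpace (E n) X]

lemma contDiffAt_comp_chartAt_symm {f : X → ℝ} (hf : ContMDiff 𝓘(ℝ, E n) 𝓘(ℝ, ℝ) ∞ f) (x : X) :
    ContDiffAt ℝ 2 (f ∘ (chartAt (E n) x).symm) (chartAt (E n) x x) := by
  have h := (contMDiffAt_iff.1 (hf x)).2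
  simp only [mfld_simps] at h
  exact contDiffAt_infty.1 (contDiffWithinAt_univ.1 h) 2

lemma isOneOne_ddc {f : X → ℝ} (hf : ContMDiff 𝓘(ℝ, E n) 𝓘(ℝ, ℝ) ∞ f) (x : X) :
    Alt2.IsOneOne (ddc (n := n) f x) :=
  isOneOne_ddcLocal (contDiffAt_comp_chartAt_symm hf x)

/-- In the preferred chart at `x`, a form takes its own value at `x`. -/
lemma inChart_chartAt_self (α : TwoForm n X) (x : X) :
    inChart (chartAt (E n) x) α (chartAt (E n) x x) = α x := by
  have hx : (chartAt (E n) x).symm (chartAt (E n) x x) = x :=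
    (chartAt (E n) x).left_inv (mem_chart_source _ x)
  have hid : (fun w => chartAt (E n) x ((chartAt (E n) x).symm w))
      =ᶠ[𝓝 (chartAt (E n) x x)] id := by
    filter_upwards [(chartAt (E n) x).open_target.mem_nhds (mem_chart_target _ x)] with w hw
    exact (chartAt (E n) x).right_inv hw
  rw [inChart, hx, hid.fderiv_eq, fderiv_id]
  ext v
  simp

lemma contDiff_topCoeff : ContDiff ℝ ∞ (Alt2.topCoeff : Alt2 n → ℝ) := by
  have hentry : ∀ j k, ContDiff ℝ ∞ fun a : Alt2 n => a.coeff j k := by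
    intro j k
    have hev : ∀ v : Fin 2 → E n, ContDiff ℝ ∞ fun a : Alt2 n => ((a v : ℝ) : ℂ) := fun v =>
      Complex.ofRealCLM.contDiff.comp (ContinuousAlternatingMap.apply ℝ (E n) ℝ v).contDiff
    exact ((hev _).sub (contDiff_const.mul (hev _))).div_const _
  refine Complex.reCLM.contDiff.comp ?_
  simp only [Matrix.det_apply']
  exact ContDiff.sum fun σ _ => contDiff_const.mul (contDiff_prod fun i _ => hentry _ _)

/-- Positivity of `Ω` keeps the determinant nonzero at the point, so its logarithm is `C²` there and
has a (1,1) `dd^c`. -/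
lemma isOneOne_ricci {Ω : TwoForm n X} (hΩ : IsKahlerForm Ω) (x : X) :
    (ricci Ω x).IsOneOne := by
  refine Alt2.IsOneOne.neg (isOneOne_ddcLocal ?_)
  have hs : ContDiffAt ℝ ∞ (inChart (chartAt (E n) x) Ω) (chartAt (E n) x x) :=
    (hΩ.smooth _ (chart_mem_atlas _ x)).contDiffAt
      ((chartAt (E n) x).open_target.mem_nhds (mem_chart_target _ x))
  have ht := (contDiff_topCoeff (n := n)).contDiffAt.comp _ hs
  refine (contDiffAt_infty.1 ht 2).log ?_
  rw [Function.comp_apply, inChart_chartAt_self]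
  exact ((hΩ.oneOne x).topCoeff_pos (hΩ.pos x)).ne'

lemma isOneOne_theta {Ω η : TwoForm n X} (hΩ : IsKahlerForm Ω) (hη : IsOneOneForm η) (t : ℝ)
    (x : X) : (theta Ω η t x).IsOneOne :=
  ((hΩ.oneOne x).add ((hη x).smul t)).sub ((isOneOne_ricci hΩ x).smul t)

/-- If a combination `∑ cᵢ fᵢ` of smooth functions has a maximum at `x`, then
`∑ cᵢ dd^c fᵢ ≤ 0` at `x`. -/
lemma sum_ddc_nonpos {ι : Type*} (s : Finset ι) (c : ι → ℝ) (f : ι → X → ℝ)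
    (hf : ∀ i ∈ s, ContMDiff 𝓘(ℝ, E n) 𝓘(ℝ, ℝ) ∞ (f i)) (x : X)
    (hmax : ∀ y, ∑ i ∈ s, c i * f i y ≤ ∑ i ∈ s, c i * f i x) (v : E n) :
    ∑ i ∈ s, c i * ddc (f i) x ![v, Complex.I • v] ≤ 0 := by
  classical
  set z := chartAt (E n) x x
  set g : ι → E n → ℝ := fun i => f i ∘ (chartAt (E n) x).symm with hg
  have hgc : ∀ i ∈ s, ContDiffAt ℝ 2 (g i) z := fun i hi => contDiffAt_comp_chartAt_symm (hf i hi) x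
  have hsum : ∀ r ⊆ s, ContDiffAt ℝ 2 (∑ i ∈ r, c i • g i) z ∧
      fderiv ℝ (fderiv ℝ (∑ i ∈ r, c i • g i)) z = ∑ i ∈ r, c i • fderiv ℝ (fderiv ℝ (g i)) z := by
    intro r
    induction r using Finset.induction_on with
    | empty =>
      intro _
      have h0 : fderiv ℝ (0 : E n → ℝ) = 0 := fderiv_zero
      simp only [Finset.sum_empty, h0, fderiv_zero]
      exact ⟨contDiffAt_const, rfl⟩
    | insert a r ha ih =>
      intro hr
      obtain ⟨h1, h2⟩ := ih fun i hi => hr (Finset.mem_insert_of_mem hi)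
      have h3 := hgc a (hr (Finset.mem_insert_self a r))
      have h4 : ContDiffAt ℝ 2 (c a • g a) z := contDiffAt_const.smul h3
      rw [Finset.sum_insert ha, Finset.sum_insert ha, fderiv_fderiv_add h4 h1, h2,
        fderiv_fderiv_const_smul h3]
      exact ⟨h4.add h1, rfl⟩
  obtain ⟨hG, hG2⟩ := hsum s subset_rfl
  have hz : (chartAt (E n) x).symm z = x := (chartAt (E n) x).left_inv (mem_chart_source _ x)
  have hloc : IsLocalMax (∑ i ∈ s, c i • g i) z := Eventually.of_forall fun w => by
    simpa [hg, hz] using hmax ((chartAt (E n) x).symm w)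
  have h1 := hloc.fderiv_fderiv_nonpos hG v
  have h2 := hloc.fderiv_fderiv_nonpos hG (Complex.I • v)
  have h3 : ∑ i ∈ s, c i * ddc (f i) x ![v, Complex.I • v] = 1 / (2 * Real.pi) *
      (fderiv ℝ (fderiv ℝ (∑ i ∈ s, c i • g i)) z v v +
        fderiv ℝ (fderiv ℝ (∑ i ∈ s, c i • g i)) z (Complex.I • v) (Complex.I • v)) := by
    simp only [hG2, _root_.sum_apply, _root_.smul_apply, smul_eq_mul]
    rw [← Finset.sum_add_distrib, Finset.mul_sum]
    refine Finset.sum_congr rfl fun i hi => ?_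
    rw [ddc, ddcLocal_diag (hgc i hi)]
    ring
  rw [h3]
  exact mul_nonpos_of_nonneg_of_nonpos (by positivity) (add_nonpos h1 h2)

end Manifold

end KRF
namespace KRF

/-! ### The parabolic maximum principle. -/

section MaximumPrinciple

/-- Only past times are compared: the backward direction `-t` is tangent to `[0, t]` at `t`. This
also covers the endpoint `t = s`. -/
lemma _root_.HasDerivWithinAt.nonneg_of_forall_le {f : ℝ → ℝ} {f' s t : ℝ}
    (hf : HasDerivWithinAt f f' (Icc 0 s) t) (ht : t ∈ Ioc 0 s)
    (hmax : ∀ r ∈ Icc 0 t, f r ≤ f t) : 0 ≤ f' := by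
  have hsub : Icc 0 t ⊆ Icc 0 s := Icc_subset_Icc_right ht.2
  have hloc : IsLocalMaxOn f (Icc 0 t) t := IsMaxOn.localize hmax
  have hy : -t ∈ posTangentConeAt (Icc 0 t) t :=
    mem_posTangentConeAt_of_segment_subset <| by
      rw [add_neg_cancel, segment_symm, segment_eq_Icc ht.1.le]
  have h := hloc.hasFDerivWithinAt_nonpos (hf.mono hsub).hasFDerivWithinAt hy
  simp only [ContinuousLinearMap.toSpanSingleton_apply, smul_eq_mul] at h
  nlinarith [ht.1]

/-- A parabolic maximum principle on `[0, s] × X`. -/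
lemma le_of_deriv_nonpos_at_spatial_max {X : Type*} [TopologicalSpace X] [CompactSpace X] {s : ℝ}
    {G G' : ℝ → X → ℝ}
    (hcont : ContinuousOn (fun p : ℝ × X => G p.1 p.2) (Icc 0 s ×ˢ univ))
    (hderiv : ∀ t ∈ Ioc 0 s, ∀ x, HasDerivWithinAt (fun r => G r x) (G' t x) (Icc 0 s) t)
    (hmax : ∀ t ∈ Ioc 0 s, ∀ x, (∀ y, G t y ≤ G t x) → G' t x ≤ 0)
    {M : ℝ} (h0 : ∀ x, G 0 x ≤ M) {t : ℝ} (ht : t ∈ Icc 0 s) (x : X) : G t x ≤ M := by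
  refine le_of_forall_pos_le_add fun ε hε => ?_
  -- Subtracting `δ` times the time makes the principle strict: at a maximum with positive time the
  -- derivative would be at least `δ`, against `hmax`.
  obtain ⟨δ, hδ, hδs⟩ : ∃ δ > 0, t * δ ≤ ε :=
    ⟨ε / (t + 1), by have := ht.1; positivity, by
      rw [mul_div_assoc', div_le_iff₀ (by linarith [ht.1])]; nlinarith [ht.1]⟩
  obtain ⟨⟨r, y⟩, ⟨hr, -⟩, hry⟩ := (isCompact_Icc.prod isCompact_univ).exists_isMaxOn
    ⟨(t, x), ht, mem_univ x⟩
    (hcont.sub (f := fun p : ℝ × X => G p.1 p.2) (g := fun p : ℝ × X => p.1 * δ) (by fun_prop))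
  have hry' : ∀ r' ∈ Icc 0 s, ∀ y', G r' y' - r' * δ ≤ G r y - r * δ := fun r' hr' y' =>
    hry (show (r', y') ∈ Icc 0 s ×ˢ univ from ⟨hr', mem_univ y'⟩)
  rcases hr.1.eq_or_lt with h | h
  · subst h
    have := hry' t ht x
    linarith [h0 y]
  · have hr' : r ∈ Ioc 0 s := ⟨h, hr.2⟩
    have h1 := hmax r hr' y fun y' => by linarith [hry' r hr y']
    have h2 := ((hderiv r hr' y).sub ((hasDerivWithinAt_id r _).mul_const δ)).nonneg_of_forall_le
      hr' fun r' hr'' => hry' r' ⟨hr''.1, hr''.2.trans hr.2⟩ y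
    linarith

end MaximumPrinciple

/-! ### Estimates along the flow. -/

section Flow

variable {n : ℕ} {X : Type*} [TopologicalSpace X] [ChartedSpace (E n) X]
  {Ω η : TwoForm n X} {h φ₀ : X → ℝ} {T : ℝ} {φ : ℝ → X → ℝ}

/-- The determinant is monotone and homogeneous of degree `n`, so the factor `c` costs `n log c`.
Positivity of `β` follows from that of `α`. -/
lemma log_topRatio_le {α β : Alt2 n} {ν c e : ℝ} (hα : α.IsOneOne) (hβ : β.IsOneOne)
    (hpos : ∀ v : E n, v ≠ 0 → 0 < α ![v, Complex.I • v]) (hc : 0 < c) (hν : 0 < ν) (he : 0 < e)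
    (hle : ∀ v : E n, α ![v, Complex.I • v] ≤ c * β ![v, Complex.I • v]) :
    Real.log (α.topCoeff / ν / e) ≤ Real.log (β.topCoeff / ν / e) + n * Real.log c := by
  have h1 : α.topCoeff ≤ (c • β).topCoeff :=
    Alt2.topCoeff_le_topCoeff hα (hβ.smul c) hpos hle
  rw [Alt2.topCoeff_smul] at h1
  have hα0 : 0 < α.topCoeff := hα.topCoeff_pos hpos
  have hβ0 : 0 < β.topCoeff := hβ.topCoeff_pos fun v hv =>
    pos_of_mul_pos_right ((hpos v hv).trans_le (hle v)) hc.le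
  rw [← Real.log_pow, ← Real.log_mul (by positivity) (by positivity)]
  refine Real.log_le_log (by positivity) ?_
  calc α.topCoeff / ν / e ≤ c ^ n * β.topCoeff / ν / e := by gcongr
    _ = β.topCoeff / ν / e * c ^ n := by ring

namespace IsCMAFSolution

lemma isOneOne (hφ : IsCMAFSolution Ω η h φ₀ T φ) (hΩ : IsKahlerForm Ω) (hη : IsOneOneForm η)
    {t : ℝ} (ht : t ∈ Ioc 0 T) (x : X) : ((theta Ω η t + ddc (φ t) : TwoForm n X) x).IsOneOne :=
  (isOneOne_theta hΩ hη t x).add (isOneOne_ddc (hφ.psh t ht).1 x)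

lemma hasDerivWithinAt (hφ : IsCMAFSolution Ω η h φ₀ T φ) {t : ℝ} (ht : t ∈ Icc 0 T) (x : X) :
    HasDerivWithinAt (fun s => φ s x) (derivWithin (fun s => φ s x) (Icc 0 T) t) (Icc 0 T) t := by
  have h1 : ContMDiff 𝓘(ℝ, ℝ) (𝓘(ℝ, ℝ).prod 𝓘(ℝ, E n)) ∞ fun s : ℝ => (s, x) :=
    contMDiff_id.prodMk contMDiff_const
  have h2 : ContMDiffOn 𝓘(ℝ, ℝ) 𝓘(ℝ, ℝ) ∞ (fun s => φ s x) (Icc 0 T) :=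
    hφ.smooth.comp h1.contMDiffOn fun s hs => ⟨hs, mem_univ x⟩
  exact (h2.contDiffOn.differentiableOn (by simp) t ht).hasDerivWithinAt

variable [CompactSpace X]

lemma le_add_mul (hφ : IsCMAFSolution Ω η h φ₀ T φ) (hΩ : IsKahlerForm Ω) (hη : IsOneOneForm η)
    (hθ : ∀ t ∈ Ioc 0 T, FormLE (theta Ω η t) ((2 : ℝ) • Ω)) {a b : ℝ} (ha : ∀ x, φ₀ x ≤ a)
    (hb : ∀ x, -h x ≤ b) {t : ℝ} (ht : t ∈ Icc 0 T) (x : X) :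
    φ t x ≤ a + t * (n * Real.log 2 + b) := by
  suffices φ t x - t * (n * Real.log 2 + b) ≤ a by linarith
  refine le_of_deriv_nonpos_at_spatial_max (s := T)
    (G := fun t x => φ t x - t * (n * Real.log 2 + b))
    (G' := fun t x => derivWithin (fun s => φ s x) (Icc 0 T) t - 1 * (n * Real.log 2 + b))
    (hφ.smooth.continuousOn.sub (by fun_prop))
    (fun t ht x => (hφ.hasDerivWithinAt (Ioc_subset_Icc_self ht) x).sub
      ((hasDerivWithinAt_id t _).mul_const _))
    ?_ (fun x => by simpa [hφ.initial] using ha x) ht x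
  intro t ht x hx
  have hddc := fun v => sum_ddc_nonpos Finset.univ (fun _ : Fin 1 => 1) (fun _ => φ t)
    (fun _ _ => (hφ.psh t ht).1) x (fun y => by simpa using hx y) v
  simp only [Finset.univ_unique, Finset.sum_singleton, one_mul] at hddc
  have hν : 0 < (Ω x).topCoeff := (hΩ.oneOne x).topCoeff_pos (hΩ.pos x)
  have key := log_topRatio_le (e := Real.exp (h x)) (hφ.isOneOne hΩ hη ht x) (hΩ.oneOne x)
    ((hφ.psh t ht).2 x) two_pos hν (Real.exp_pos _) fun v => by
      have h1 := hθ t ht x v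
      have h2 := hddc v
      rw [Pi.smul_apply, ContinuousAlternatingMap.smul_apply, smul_eq_mul] at h1
      rw [Pi.add_apply, ContinuousAlternatingMap.add_apply]
      linarith
  rw [div_self hν.ne', one_div, Real.log_inv, Real.log_exp] at key
  have hflow := hφ.flow t ht x
  rw [topRatio] at hflow
  linarith [hb x]

/-- Comparison of the flow with its rescaling in time. -/
lemma rescaled_le (hφ : IsCMAFSolution Ω η h φ₀ T φ) (hΩ : IsKahlerForm Ω) (hη : IsOneOneForm η)
    (hφ₀ : IsSmoothStrictlyPSH Ω φ₀) {l s : ℝ} (hl : 1 ≤ l) (hs : 0 ≤ s) (hls : l * s ≤ T) (x : X) :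
    l⁻¹ * φ (l * s) x + (1 - l⁻¹) * φ₀ x - φ s x ≤ s * (n * Real.log l) := by
  have hl0 : 0 < l := one_pos.trans_le hl
  have hl1 : l⁻¹ ≤ 1 := inv_le_one_of_one_le₀ hl
  have hle : s ≤ l * s := le_mul_of_one_le_left hs hl
  have hmap : MapsTo (fun r => l * r) (Icc 0 s) (Icc 0 T) := fun r hr =>
    ⟨mul_nonneg hl0.le hr.1, (mul_le_mul_of_nonneg_left hr.2 hl0.le).trans hls⟩
  have hsub : Icc 0 s ⊆ Icc 0 T := Icc_subset_Icc_right (hle.trans hls)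
  suffices l⁻¹ * φ (l * s) x + (1 - l⁻¹) * φ₀ x - φ s x - s * (n * Real.log l) ≤ 0 by linarith
  refine le_of_deriv_nonpos_at_spatial_max (s := s)
    (G := fun r x => l⁻¹ * φ (l * r) x + (1 - l⁻¹) * φ₀ x - φ r x - r * (n * Real.log l))
    (G' := fun r x => l⁻¹ * (derivWithin (fun s => φ s x) (Icc 0 T) (l * r) * (l * 1))
      - derivWithin (fun s => φ s x) (Icc 0 T) r - 1 * (n * Real.log l))
    ?_ ?_ ?_ (fun x => ?_) ⟨hs, le_rfl⟩ x
  · have h1 : ContinuousOn (fun p : ℝ × X => φ (l * p.1) p.2) (Icc 0 s ×ˢ univ) :=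
      hφ.smooth.continuousOn.comp
        (f := fun p : ℝ × X => (l * p.1, p.2)) (by fun_prop) fun p hp => ⟨hmap hp.1, mem_univ _⟩
    have h2 : ContinuousOn (fun p : ℝ × X => φ p.1 p.2) (Icc 0 s ×ˢ univ) :=
      hφ.smooth.continuousOn.mono (prod_mono_left hsub)
    have h3 : Continuous φ₀ := hφ₀.1.continuous
    exact (((continuousOn_const.mul h1).add (by fun_prop)).sub h2).sub (by fun_prop)
  · intro r hr y
    have hr' := Ioc_subset_Icc_self hr
    have h1 := (hφ.hasDerivWithinAt (hmap hr') y).comp r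
      ((hasDerivWithinAt_id r (Icc 0 s)).const_mul l) hmap
    exact (((h1.const_mul l⁻¹).add_const _).sub
      ((hφ.hasDerivWithinAt (hsub hr') y).mono hsub)).sub ((hasDerivWithinAt_id r _).mul_const _)
  · intro r hr y hy
    have hr1 : r ∈ Ioc 0 T := ⟨hr.1, (hsub (Ioc_subset_Icc_self hr)).2⟩
    have hr2 : l * r ∈ Ioc 0 T := ⟨mul_pos hl0 hr.1, (hmap (Ioc_subset_Icc_self hr)).2⟩
    -- The terms `r n log l` are constant in space, so only the three potentials enter the spatial
    -- maximum condition.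
    have hddc := fun v => sum_ddc_nonpos Finset.univ ![l⁻¹, 1 - l⁻¹, -1] ![φ (l * r), φ₀, φ r]
      (fun i _ => by
        fin_cases i
        · exact (hφ.psh _ hr2).1
        · exact hφ₀.1
        · exact (hφ.psh _ hr1).1) y (fun y' => by
        have := hy y'
        simp only [Fin.sum_univ_three, Matrix.cons_val]
        linarith) v
    simp only [Fin.sum_univ_three, Matrix.cons_val] at hddc
    have hν : 0 < (Ω y).topCoeff := (hΩ.oneOne y).topCoeff_pos (hΩ.pos y)
    have key := log_topRatio_le (e := Real.exp (h y)) (hφ.isOneOne hΩ hη hr2 y)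
      (hφ.isOneOne hΩ hη hr1 y) ((hφ.psh _ hr2).2 y) hl0 hν (Real.exp_pos _) fun v => by
        have h1 := hddc v
        have h2 : 0 ≤ (Ω + ddc φ₀ : TwoForm n X) y ![v, Complex.I • v] := by
          rcases eq_or_ne v 0 with rfl | hv
          · rw [smul_zero, Alt2.apply_self]
          · exact (hφ₀.2 y v hv).le
        simp only [theta, Pi.add_apply, Pi.sub_apply, Pi.smul_apply,
          ContinuousAlternatingMap.add_apply, ContinuousAlternatingMap.sub_apply,
          ContinuousAlternatingMap.smul_apply, smul_eq_mul] at h2 ⊢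
        -- The required inequality is `l` times the maximum condition plus `l - 1` times the
        -- positivity of `Ω + dd^c φ₀`; the terms in `η` and `ricci Ω` cancel, both being multiplied
        -- by `l r`.
        have h3 := mul_nonneg (sub_nonneg.2 hl) h2
        have h4 := mul_nonpos_of_nonneg_of_nonpos hl0.le h1
        have h5 : l * (l⁻¹ * ddc (φ (l * r)) y ![v, Complex.I • v]
            + (1 - l⁻¹) * ddc φ₀ y ![v, Complex.I • v] + -1 * ddc (φ r) y ![v, Complex.I • v])
            = ddc (φ (l * r)) y ![v, Complex.I • v] + (l - 1) * ddc φ₀ y ![v, Complex.I • v]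
              - l * ddc (φ r) y ![v, Complex.I • v] := by
          field_simp
          ring
        rw [h5] at h4
        linarith
    have e1 := hφ.flow _ hr1 y
    have e2 := hφ.flow _ hr2 y
    rw [topRatio] at e1 e2
    rw [mul_one, mul_comm _ l, inv_mul_cancel_left₀ hl0.ne', e1, e2]
    linarith
  · simp [hφ.initial]
    linarith

lemma derivWithin_le (hφ : IsCMAFSolution Ω η h φ₀ T φ) (hΩ : IsKahlerForm Ω)
    (hη : IsOneOneForm η) (hφ₀ : IsSmoothStrictlyPSH Ω φ₀) {t : ℝ} (ht : t ∈ Ioc 0 T) (x : X) :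
    derivWithin (fun s => φ s x) (Icc 0 T) t ≤ (φ t x - φ₀ x) / t + n := by
  have hd := (hφ.hasDerivWithinAt (Ioc_subset_Icc_self ht) x)
  -- The function `s ↦ s ((φ_t - φ₀) / t + n) - φ_s` is largest on `[0, t]` at `s = t`, so its
  -- derivative there is nonnegative.
  have h1 := (((hasDerivWithinAt_id t (Icc 0 T)).mul_const ((φ t x - φ₀ x) / t + n)).sub
    hd).nonneg_of_forall_le ht fun s hs => by
      have ht0 := ht.1
      have hn : (0 : ℝ) ≤ n := n.cast_nonneg
      have e1 : t * ((φ t x - φ₀ x) / t + n) = φ t x - φ₀ x + t * n := by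
        field_simp
      have e2 : s * ((φ t x - φ₀ x) / t + n) = s / t * (φ t x - φ₀ x) + s * n := by ring
      show s * ((φ t x - φ₀ x) / t + n) - φ s x ≤ t * ((φ t x - φ₀ x) / t + n) - φ t x
      rw [e1, e2]
      rcases hs.1.eq_or_lt with rfl | hs0
      · simp only [zero_div, zero_mul, hφ.initial]
        nlinarith
      -- Rescaling by `l = t / s` carries time `s` to time `t`; then `log (t / s) ≤ t / s - 1`
      -- bounds the error by `n (t - s)`.
      · have hts : t / s * s = t := div_mul_cancel₀ _ hs0.ne'
        have h2 := hφ.rescaled_le hΩ hη hφ₀ (l := t / s) ((one_le_div hs0).2 hs.2) hs0.le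
          (hts.le.trans ht.2) x
        rw [hts, inv_div] at h2
        have h3 := Real.log_le_sub_one_of_pos (div_pos ht0 hs0)
        have h4 : s * (n * Real.log (t / s)) ≤ n * (t - s) := by
          have := mul_le_mul_of_nonneg_left h3 (mul_nonneg hs0.le hn)
          nlinarith
        linarith
  linarith

end IsCMAFSolution

end Flow

end KRF

/-! ### Combination of the two bounds. -/

theorem mainTheorem10 (n : ℕ) :
    ∃ C : ℝ → ℝ → ℝ, (∀ a b : ℝ, 0 < C a b) ∧
      ∀ (X : Type*) [TopologicalSpace X] [T2Space X] [CompactSpace X]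
        [ChartedSpace (KRF.E n) X] [IsManifold 𝓘(ℂ, KRF.E n) ω X]
        (Ω η : KRF.TwoForm n X) (h φ₀ : X → ℝ) (T : ℝ) (φ : ℝ → X → ℝ),
        KRF.IsKahlerForm Ω →
        KRF.IsSmoothForm η → KRF.IsClosedForm η → KRF.IsOneOneForm η →
        ContMDiff 𝓘(ℝ, KRF.E n) 𝓘(ℝ, ℝ) ∞ h →
        0 < T →
        (∀ t ∈ Ioc 0 T,
          KRF.FormLE ((1 / 2 : ℝ) • Ω) (KRF.theta Ω η t) ∧
          KRF.FormLE (KRF.theta Ω η t) ((2 : ℝ) • Ω)) →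
        KRF.IsSmoothStrictlyPSH Ω φ₀ →
        KRF.IsCMAFSolution Ω η h φ₀ T φ →
        ∀ t ∈ Ioc 0 T, ∀ x : X,
          derivWithin (fun s => φ s x) (Icc 0 T) t ≤
            (-φ₀ x + C (⨆ y, φ₀ y) (-⨅ y, h y)) / t + C (⨆ y, φ₀ y) (-⨅ y, h y) := by
  -- One constant dominates both `a`, needed over `t`, and `b + n + n log 2`, needed outside; the
  -- summand 1 gives strict positivity.
  refine ⟨fun a b => 1 + |a| + |b| + n + n * Real.log 2, fun a b => ?_, ?_⟩
  · have := Real.log_pos one_lt_two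
    positivity
  intro X _ _ _ _ _ Ω η h φ₀ T φ hΩ _ _ hη hh hT hθ hφ₀ hφ t ht x
  set a := ⨆ y, φ₀ y
  set b := -⨅ y, h y with hb
  have ha : ∀ y, φ₀ y ≤ a := le_ciSup (isCompact_range hφ₀.1.continuous).bddAbove
  have hb : ∀ y, -h y ≤ b := fun y =>
    neg_le_neg (ciInf_le (isCompact_range hh.continuous).bddBelow y)
  have h1 := hφ.le_add_mul hΩ hη (fun t ht => (hθ t ht).2) ha hb (Ioc_subset_Icc_self ht) x
  refine (hφ.derivWithin_le hΩ hη hφ₀ ht x).trans ?_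
  have hlog := Real.log_pos one_lt_two
  have hn : (0 : ℝ) ≤ n := n.cast_nonneg
  have hnl := mul_nonneg hn hlog.le
  have h2 : (φ t x - φ₀ x) / t ≤ (-φ₀ x + a) / t + (n * Real.log 2 + b) := by
    rw [div_add' _ _ _ ht.1.ne']
    gcongr
    · exact ht.1.le
    · linarith
  have h3 : (-φ₀ x + a) / t ≤ (-φ₀ x + (1 + |a| + |b| + n + n * Real.log 2)) / t := by
    gcongr
    · exact ht.1.le
    · linarith [le_abs_self a, abs_nonneg b]
  linarith [le_abs_self b, abs_nonneg a]
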